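/- Let $k \ge 0$ and $d \ge 1$ be integers and put $s = (k+1)/d$. For $N \ge 1$ let $n = N^d$, and let $D$ be the oriented edge incidence matrix of the $d$-dimensional grid graph with $N$ vertices along each side, so that $(D\theta)_{(x,x+e_j)} = \theta(x+e_j) - \theta(x)$ for every edge $(x, x+e_j)$ of the grid. Let $L = D^{\mathsf T} D$ be the graph Laplacian, and for integers $q \ge 0$ put $S_{n,d}^{(2q)} = L^q$ and $S_{n,d}^{(2q+1)} = D L^q$. For $C_n \ge 0$ define the graph total variation class $$\mathcal S_{n,d}^k(C_n) = \{\theta \in \mathbb R^n : \|S_{n,d}^{(k+1)} \theta\|_1 \le C_n\}.$$ For $\mathcal K \subseteq \mathbb R^n$ let $$R(\mathcal K) = \inf_{\hat\theta} \sup_{\theta_0 \in \mathcal K} \frac1n \mathbb E\|\hat\theta(y) - \theta_0\|_2^2$$ be the minimax risk over $\mathcal K$ from observations $y_i \sim N(\theta_{0,i}, \sigma^2)$, independent for $i = 1,\dots,n$, the infimum being over all measurable estimators $\hat\theta : \mathbb R^n \to \mathbb R^n$. Then $$R\big(\mathcal S_{n,d}^k(C_n)\big) = \Omega\left(\frac{\sigma^2}{n}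 + \Big(\frac{\sigma C_n}{n} \wedge \sigma^2\Big) + \Big(\Big(\frac{C_n}{n}\Big)^{\frac{2}{2s+1}} \sigma^{\frac{4s}{2s+1}} \wedge \sigma^2\Big)\right),$$ that is, there is a constant $c > 0$ depending only on $k$ and $d$ such that, for all $N \ge 1$, all $\sigma > 0$ and all $C_n \ge 0$, the minimax risk is at least $c$ times the expression in parentheses. -/

import Mathlib

open MeasureTheory ProbabilityTheory
open scoped ENNReal

/-- The law of the observation `y` in the normal means model with mean vector `θ`: the
coordinates `y i ∼ N(θ i, σ²)` are independent. -/
noncomputable def gaussianObs {ι : Type*} [Fintype ι] (σ : ℝ) (θ : ι → ℝ) : Measure (ι → ℝ) :=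
  Measure.pi fun i => gaussianReal (θ i) (σ ^ 2).toNNReal

/-- The risk `(1/n) 𝔼 ‖θ̂(y) - θ‖₂²` of an estimator `est` at the mean vector `θ`, where `n` is
the number of observations; its value lies in `[0, ∞]`. -/
noncomputable def estimationRisk {ι : Type*} [Fintype ι] (σ : ℝ)
    (est : (ι → ℝ) → (ι → ℝ)) (θ : ι → ℝ) : ℝ≥0∞ :=
  ∫⁻ y, ENNReal.ofReal ((∑ i, (est y i - θ i) ^ 2) / (Fintype.card ι : ℝ)) ∂(gaussianObs σ θ)

/-- The minimax risk over `K`: the infimum over all measurable estimators of the largest risk at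
a mean vector in `K`. -/
noncomputable def normalMinimaxRisk {ι : Type*} [Fintype ι] (σ : ℝ) (K : Set (ι → ℝ)) : ℝ≥0∞ :=
  ⨅ (est : (ι → ℝ) → (ι → ℝ)) (_ : Measurable est), ⨆ θ ∈ K, estimationRisk σ est θ

/-- The `N ^ d` points of the `d`-dimensional lattice with `N` points along each side. -/
abbrev GridPoint (d N : ℕ) : Type := Fin d → Fin N

/-- The edges of the grid graph on the lattice: each undirected edge occurs exactly once, as the
pair `(x, x + e_j)`. -/
abbrev GridEdge (d N : ℕ) : Type :=
  {p : GridPoint d N × GridPoint d N //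
    ∃ j, (p.2 j : ℕ) = (p.1 j : ℕ) + 1 ∧ ∀ i, i ≠ j → p.2 i = p.1 i}

/-- The oriented edge incidence matrix `D` of the grid graph, so that
`(D θ) (x, x + e_j) = θ (x + e_j) - θ x`. -/
def gridIncidence (d N : ℕ) : Matrix (GridEdge d N) (GridPoint d N) ℝ :=
  Matrix.of fun e x => (if x = e.1.2 then 1 else 0) - (if x = e.1.1 then 1 else 0)

/-- The graph Laplacian `L = Dᵀ D` of the grid graph. -/
def gridLaplacian (d N : ℕ) : Matrix (GridPoint d N) (GridPoint d N) ℝ :=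
  (gridIncidence d N).transpose * gridIncidence d N

/-- The `ℓ¹` norm `‖S⁽ᵐ⁾ θ‖₁` for the graph trend filtering operator of order `m` on the grid,
`S⁽²ᵍ⁾ = L ^ q` and `S⁽²ᵍ⁺¹⁾ = D L ^ q`. -/
def gtfNorm (d N m : ℕ) (θ : GridPoint d N → ℝ) : ℝ :=
  if Even m then
    ∑ x, |(gridLaplacian d N ^ (m / 2)).mulVec θ x|
  else
    ∑ e, |(gridIncidence d N * gridLaplacian d N ^ (m / 2)).mulVec θ e|

/-- The graph total variation class of order `k` and radius `C`: all `θ` with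
`‖S⁽ᵏ⁺¹⁾ θ‖₁ ≤ C`. -/
def gtvClass (k d N : ℕ) (C : ℝ) : Set (GridPoint d N → ℝ) :=
  {θ | gtfNorm d N (k + 1) θ ≤ C}

/-! The engine is Assouad's lemma on a rotated hypercube (`assouad_bound`): if the `v j`, `j ∈ J`,
are orthonormal and every signal `σ ∑ ± v j` lies in the class, then the minimax risk is at least a
constant times `σ² |J| / n`. Flipping one sign moves the mean by only `2σ` in `ℓ²`, so no estimator
can detect it reliably, and by Bessel the errors along the different `v j` add up.

Each of the three terms comes from one choice of `v`. The constant vector is annihilated by `D` and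
gives `σ² / n` (`constant_bound`). Coordinate vectors give the second term: `S⁽ᵏ⁺¹⁾` is bounded on
`ℓ¹` by `(4d)^(k+1)`, so about `C / σ` spikes of height `σ` fit into the class (`spike_bound`,
`sparse_rate_bound`).

The third term uses the `r ^ d` lowest Neumann cosines, whose eigenvalues are at most `d (π (r - 1)
/ N)²`. By Cauchy–Schwarz, `‖S⁽ᵏ⁺¹⁾θ‖₁² ≤ d n ‖S⁽ᵏ⁺¹⁾θ‖₂²`, which with `r ≈ N z` is of order `n² σ²
z^(2(k+1)+d)`. The largest admissible `z` is of order `(C / (nσ))^(2 / (2(k+1)+d))`, and `σ² z^d` is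
the claimed rate (`low_frequency_bound`, `smooth_rate_bound`). -/

/-- The joint density of the normal means model. -/
noncomputable def gaussianObsPDF {ι : Type*} [Fintype ι] (σ : ℝ) (θ y : ι → ℝ) : ℝ :=
  ∏ i, gaussianPDFReal (θ i) (σ ^ 2).toNNReal (y i)

/-! ### Gaussian likelihoods, the two point bound and Assouad's lemma. -/

section

variable {ι : Type*} [Fintype ι] {σ : ℝ}

lemma toNNReal_sq_ne_zero (hσ : 0 < σ) : (σ ^ 2).toNNReal ≠ 0 := by
  simp [hσ.ne']

lemma gaussianObsPDF_pos (hσ : 0 < σ) (θ y : ι → ℝ) : 0 < gaussianObsPDF σ θ y :=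
  Finset.prod_pos fun _ _ => gaussianPDFReal_pos _ _ _ (toNNReal_sq_ne_zero hσ)

lemma measurable_gaussianObsPDF (σ : ℝ) (θ : ι → ℝ) : Measurable (gaussianObsPDF σ θ) :=
  Finset.measurable_prod _ fun i _ =>
    (measurable_gaussianPDFReal _ _).comp (measurable_pi_apply i)

lemma gaussianObs_eq_withDensity (hσ : 0 < σ) (θ : ι → ℝ) :
    gaussianObs σ θ =
      (volume : Measure (ι → ℝ)).withDensity fun y => ENNReal.ofReal (gaussianObsPDF σ θ y) := by
  have hv := toNNReal_sq_ne_zero hσ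
  refine Measure.pi_eq fun s hs => ?_
  rw [withDensity_apply _ (MeasurableSet.univ_pi hs), volume_pi, Measure.restrict_pi_pi,
    ← ofReal_integral_eq_lintegral_ofReal]
  · simp only [gaussianObsPDF]
    rw [integral_fintype_prod_eq_prod (fun i => gaussianPDFReal (θ i) (σ ^ 2).toNNReal),
      ENNReal.ofReal_prod_of_nonneg]
    · exact Finset.prod_congr rfl fun i _ => (gaussianReal_apply_eq_integral _ hv _).symm
    · exact fun i _ => integral_nonneg fun x => gaussianPDFReal_nonneg _ _ _
  · exact Integrable.fintype_prod (f := fun i => gaussianPDFReal (θ i) (σ ^ 2).toNNReal)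
      fun i => (integrable_gaussianPDFReal _ _).restrict
  · exact Filter.Eventually.of_forall fun y => (gaussianObsPDF_pos hσ θ y).le

instance (θ : ι → ℝ) : IsProbabilityMeasure (gaussianObs σ θ) := by
  unfold gaussianObs; infer_instance

lemma lintegral_gaussianObsPDF (hσ : 0 < σ) (θ : ι → ℝ) :
    ∫⁻ y, ENNReal.ofReal (gaussianObsPDF σ θ y) = 1 := by
  have h : gaussianObs σ θ Set.univ = 1 := measure_univ
  rwa [gaussianObs_eq_withDensity hσ, withDensity_apply _ MeasurableSet.univ,
    Measure.restrict_univ] at h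

lemma lintegral_gaussianObs (hσ : 0 < σ) (θ : ι → ℝ) {f : (ι → ℝ) → ℝ≥0∞} (hf : Measurable f) :
    ∫⁻ y, f y ∂gaussianObs σ θ = ∫⁻ y, ENNReal.ofReal (gaussianObsPDF σ θ y) * f y := by
  rw [gaussianObs_eq_withDensity hσ, lintegral_withDensity_eq_lintegral_mul _
    (measurable_gaussianObsPDF σ θ).ennreal_ofReal hf]
  rfl

/-- The parallelogram law in the exponent. It compares both shifted densities with the centred one
pointwise, which replaces a total variation or Hellinger estimate. -/
lemma gaussianObsPDF_mul (hσ : 0 < σ) (θ h y : ι → ℝ) :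
    gaussianObsPDF σ (θ + h) y * gaussianObsPDF σ (θ - h) y =
      Real.exp (-((∑ i, h i ^ 2) / σ ^ 2)) * gaussianObsPDF σ θ y ^ 2 := by
  have e : Real.exp (-((∑ i, h i ^ 2) / σ ^ 2)) = ∏ i, Real.exp (-(h i ^ 2 / σ ^ 2)) := by
    rw [← Real.exp_sum, Finset.sum_neg_distrib, Finset.sum_div]
  rw [e, gaussianObsPDF, gaussianObsPDF, gaussianObsPDF, ← Finset.prod_pow, ← Finset.prod_mul_distrib,
    ← Finset.prod_mul_distrib]
  refine Finset.prod_congr rfl fun i _ => ?_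
  simp only [gaussianPDFReal, Pi.add_apply, Pi.sub_apply, Real.coe_toNNReal _ (sq_nonneg σ)]
  rw [mul_pow, mul_mul_mul_comm, mul_left_comm (Real.exp (-(h i ^ 2 / σ ^ 2))), ← pow_two]
  congr 1
  rw [← Real.exp_add, ← Real.exp_nat_mul, ← Real.exp_add]
  congr 1
  field_simp
  push_cast
  ring

/-- Two point bound: any real statistic errs at one of two means at distance `2‖h‖`. -/
lemma two_point_bound (hσ : 0 < σ) (θ h : ι → ℝ) (hh : ∑ i, h i ^ 2 = σ ^ 2)
    {a b : (ι → ℝ) → ℝ} (ha : Measurable a) (hb : Measurable b) (ha0 : ∀ y, 0 ≤ a y)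
    (hb0 : ∀ y, 0 ≤ b y) {t : ℝ} (ht : 0 ≤ t) (hab : ∀ y, t ≤ a y + b y) :
    ENNReal.ofReal (Real.exp (-1) / 2 * t) ≤
      ∫⁻ y, ENNReal.ofReal (a y) ∂gaussianObs σ (θ + h) +
        ∫⁻ y, ENNReal.ofReal (b y) ∂gaussianObs σ (θ - h) := by
  rw [lintegral_gaussianObs hσ _ ha.ennreal_ofReal, lintegral_gaussianObs hσ _ hb.ennreal_ofReal,
    ← lintegral_add_left (f := fun y : ι → ℝ =>
      ENNReal.ofReal (gaussianObsPDF σ (θ + h) y) * ENNReal.ofReal (a y))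
      ((measurable_gaussianObsPDF σ _).ennreal_ofReal.mul ha.ennreal_ofReal)]
  set F := fun y : ι → ℝ => ENNReal.ofReal (gaussianObsPDF σ (θ + h) y) * ENNReal.ofReal (a y) +
    ENNReal.ofReal (gaussianObsPDF σ (θ - h) y) * ENNReal.ofReal (b y)
  set c : ℝ := Real.exp (-1) * t / 4 with hc
  have hc0 : 0 ≤ c := by positivity
  -- With densities `p`, `q` at the two means and `r` at the midpoint, `p q t = 4 c r²` and `p q t ≤
  -- (p + q)(p a + q b)`. Together with `4 r (p + q) ≤ 4 r² + (p + q)²` this is the claim after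
  -- division by `p + q`. Integration then leaves `4c - 2c = 2c`.
  have key : ∀ y, ENNReal.ofReal (4 * c) * ENNReal.ofReal (gaussianObsPDF σ θ y) ≤
      F y + ENNReal.ofReal c * (ENNReal.ofReal (gaussianObsPDF σ (θ + h) y) +
        ENNReal.ofReal (gaussianObsPDF σ (θ - h) y)) := by
    intro y
    have hp := gaussianObsPDF_pos hσ (θ + h) y
    have hq := gaussianObsPDF_pos hσ (θ - h) y
    have hr := gaussianObsPDF_pos hσ θ y
    have hm := gaussianObsPDF_mul hσ θ h y
    rw [hh, div_self (by positivity)] at hm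
    simp only [F]
    generalize gaussianObsPDF σ (θ + h) y = p at *
    generalize gaussianObsPDF σ (θ - h) y = q at *
    generalize gaussianObsPDF σ θ y = r at *
    have ha := ha0 y
    have hb := hb0 y
    have hab := hab y
    generalize a y = a at *
    generalize b y = b at *
    rw [← ENNReal.ofReal_mul hp.le, ← ENNReal.ofReal_mul hq.le, ← ENNReal.ofReal_mul (by positivity),
      ← ENNReal.ofReal_add hp.le hq.le, ← ENNReal.ofReal_mul hc0,
      ← ENNReal.ofReal_add (by positivity) (by positivity),
      ← ENNReal.ofReal_add (by positivity) (by positivity)]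
    refine ENNReal.ofReal_le_ofReal ?_
    have h1 : p * q * t ≤ (p + q) * (p * a + q * b) := by
      have : 0 ≤ p ^ 2 * a + q ^ 2 * b := by positivity
      have : p * q * t ≤ p * q * (a + b) := by gcongr
      nlinarith
    have h2 : p * q * t = 4 * c * r ^ 2 := by rw [hm, hc]; ring
    have h3 : 4 * c * r * (p + q) ≤ (p * a + q * b + c * (p + q)) * (p + q) := by
      nlinarith [mul_nonneg hc0 (sq_nonneg (2 * r - (p + q)))]
    exact le_of_mul_le_mul_right h3 (by positivity)
  have hint := lintegral_mono (μ := volume) key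
  rw [lintegral_const_mul _ (measurable_gaussianObsPDF σ _).ennreal_ofReal,
    lintegral_gaussianObsPDF hσ, mul_one, lintegral_add_right F, lintegral_const_mul,
    lintegral_add_right (fun y => ENNReal.ofReal (gaussianObsPDF σ (θ + h) y)),
    lintegral_gaussianObsPDF hσ, lintegral_gaussianObsPDF hσ] at hint
  · have e : ENNReal.ofReal (4 * c) =
        ENNReal.ofReal (Real.exp (-1) / 2 * t) + ENNReal.ofReal c * (1 + 1) := by
      rw [one_add_one_eq_two, ← ENNReal.ofReal_ofNat, ← ENNReal.ofReal_mul hc0,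
        ← ENNReal.ofReal_add (by positivity) (by positivity), hc]
      congr 1
      ring
    rw [e] at hint
    exact (ENNReal.add_le_add_iff_right
      (ENNReal.mul_ne_top ENNReal.ofReal_ne_top (by simp))).1 hint
  · exact (measurable_gaussianObsPDF σ _).ennreal_ofReal
  · exact (measurable_gaussianObsPDF σ _).ennreal_ofReal.add
      (measurable_gaussianObsPDF σ _).ennreal_ofReal
  · exact ((measurable_gaussianObsPDF σ _).ennreal_ofReal.add
      (measurable_gaussianObsPDF σ _).ennreal_ofReal).const_mul _

lemma sum_sq_le_of_orthonormal {J : Type*} [Fintype J] [DecidableEq J] {v : J → ι → ℝ}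
    (hv : ∀ j l, ∑ i, v j i * v l i = if j = l then 1 else 0) (w : ι → ℝ) :
    ∑ j, (∑ i, v j i * w i) ^ 2 ≤ ∑ i, w i ^ 2 := by
  have ho : Orthonormal ℝ fun j => (WithLp.toLp 2 (v j) : EuclideanSpace ℝ ι) := by
    rw [orthonormal_iff_ite]
    intro j l
    rw [PiLp.inner_apply, ← hv]
    simp [mul_comm]
  have := ho.sum_inner_products_le (WithLp.toLp 2 w : EuclideanSpace ℝ ι) (s := Finset.univ)
  simpa [PiLp.inner_apply, EuclideanSpace.norm_sq_eq, mul_comm] using this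

/-- The sign attached to a boolean. -/
def boolSign (b : Bool) : ℝ := if b then 1 else -1

@[simp] lemma boolSign_sq (b : Bool) : boolSign b ^ 2 = 1 := by
  cases b <;> simp [boolSign]

lemma sum_mul_combination_of_orthonormal {J : Type*} [Fintype J] [DecidableEq J] {v : J → ι → ℝ}
    (hv : ∀ j l, ∑ i, v j i * v l i = if j = l then 1 else 0) (a : J → ℝ) (j : J) :
    ∑ i, v j i * ∑ l, a l * v l i = a j := by
  simp_rw [Finset.mul_sum]
  rw [Finset.sum_comm]
  have : ∀ l, ∑ i, v j i * (a l * v l i) = a l * if j = l then 1 else 0 := fun l => by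
    rw [← hv, Finset.mul_sum]; exact Finset.sum_congr rfl fun i _ => by ring
  simp [this]

lemma sum_sq_combination_of_orthonormal {J : Type*} [Fintype J] [DecidableEq J] {v : J → ι → ℝ}
    (hv : ∀ j l, ∑ i, v j i * v l i = if j = l then 1 else 0) (a : J → ℝ) :
    ∑ i, (∑ l, a l * v l i) ^ 2 = ∑ j, a j ^ 2 := by
  have : ∀ i, (∑ l, a l * v l i) ^ 2 = ∑ j, a j * (v j i * ∑ l, a l * v l i) := fun i => by
    rw [pow_two, Finset.sum_mul]
    exact Finset.sum_congr rfl fun j _ => by ring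
  simp_rw [this]
  rw [Finset.sum_comm]
  refine Finset.sum_congr rfl fun j _ => ?_
  rw [← Finset.mul_sum, sum_mul_combination_of_orthonormal hv, pow_two]

/-- Assouad's bound for a rotated hypercube with vertices `σ ∑ ± v j`. -/
lemma assouad_bound (hσ : 0 < σ) {K : Set (ι → ℝ)} {J : Type*} [Fintype J] [DecidableEq J]
    {v : J → ι → ℝ} (hv : ∀ j l, ∑ i, v j i * v l i = if j = l then 1 else 0)
    (hK : ∀ τ : J → Bool, (fun i => ∑ j, σ * boolSign (τ j) * v j i) ∈ K) :
    ENNReal.ofReal (Real.exp (-1) / 2 * (σ ^ 2 * Fintype.card J / Fintype.card ι)) ≤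
      normalMinimaxRisk σ K := by
  refine le_iInf₂ fun est hest => ?_
  set R := ⨆ θ ∈ K, estimationRisk σ est θ with hR
  set θ : (J → Bool) → ι → ℝ := fun τ i => ∑ j, σ * boolSign (τ j) * v j i with hθ
  set n : ℝ := (Fintype.card ι : ℝ)
  set a : J → (J → Bool) → (ι → ℝ) → ℝ := fun j τ y =>
    (∑ i, v j i * est y i - σ * boolSign (τ j)) ^ 2 / n with ha
  have hn0 : 0 ≤ n := by positivity
  have hma : ∀ j τ, Measurable (a j τ) := fun j τ => by
    have : ∀ i, Measurable fun y => est y i := fun i => (measurable_pi_apply i).comp hest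
    simp only [ha]
    fun_prop
  have ha0 : ∀ j τ y, 0 ≤ a j τ y := fun j τ y => by simp only [ha]; positivity
  set φ : J → (J → Bool) → ℝ≥0∞ := fun j τ => ∫⁻ y, ENNReal.ofReal (a j τ y) ∂gaussianObs σ (θ τ)
    with hφ
  -- Bessel's inequality: the loss dominates the sum of the squared errors along the `v j`.
  have hrisk : ∀ τ, ∑ j, φ j τ ≤ R := fun τ => by
    refine le_trans ?_ (le_iSup₂ (f := fun θ (_ : θ ∈ K) => estimationRisk σ est θ) (θ τ) (hK τ))
    simp only [hφ]
    rw [← lintegral_finsetSum _ fun j _ => (hma j τ).ennreal_ofReal]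
    refine lintegral_mono fun y => ?_
    dsimp only
    rw [← ENNReal.ofReal_sum_of_nonneg fun j _ => ha0 j τ y]
    refine ENNReal.ofReal_le_ofReal ?_
    simp only [ha]
    rw [← Finset.sum_div]
    refine div_le_div_of_nonneg_right ?_ hn0
    refine le_trans (le_of_eq ?_) (sum_sq_le_of_orthonormal hv fun i => est y i - θ τ i)
    refine Finset.sum_congr rfl fun j _ => ?_
    simp_rw [mul_sub, Finset.sum_sub_distrib]
    rw [sum_mul_combination_of_orthonormal hv fun j => σ * boolSign (τ j)]
  set flip : J → (J → Bool) → (J → Bool) := fun j τ => Function.update τ j (!τ j) with hflip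
  have hflipinv : ∀ j, Function.Involutive (flip j) := fun j τ => by
    simp [hflip]
  set c := ENNReal.ofReal (Real.exp (-1) / 2 * (2 * σ ^ 2 / n)) with hc
  -- The two means are `η ± σ v j`, and `(u - σ)² + (u + σ)² ≥ 2σ²` for every value `u` of the
  -- estimated coordinate.
  have htrue : ∀ j τ, τ j = true → c ≤ φ j τ + φ j (flip j τ) := fun j τ hτ => by
    have h1 : ∃ η, θ τ = η + (fun i => σ * v j i) ∧ θ (flip j τ) = η - fun i => σ * v j i := by
      refine ⟨fun i => ∑ l ∈ Finset.univ.erase j, σ * boolSign (τ l) * v l i, ?_, ?_⟩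
      · ext i
        simp only [hθ, Pi.add_apply]
        rw [← Finset.sum_erase_add _ _ (Finset.mem_univ j)]
        simp [hτ, boolSign]
      · ext i
        simp only [hθ, Pi.sub_apply]
        rw [← Finset.sum_erase_add _ _ (Finset.mem_univ j)]
        have : ∑ l ∈ Finset.univ.erase j, σ * boolSign (flip j τ l) * v l i =
            ∑ l ∈ Finset.univ.erase j, σ * boolSign (τ l) * v l i :=
          Finset.sum_congr rfl fun l hl => by simp [hflip, Finset.ne_of_mem_erase hl]
        rw [this]
        simp [hflip, hτ, boolSign, sub_eq_add_neg]
    obtain ⟨η, e1, e2⟩ := h1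
    simp only [hφ]
    rw [e1, e2]
    refine two_point_bound hσ η _ ?_ (hma _ _) (hma _ _) (ha0 _ _) (ha0 _ _) (by positivity) ?_
    · have := hv j j
      simp_rw [mul_pow, ← Finset.mul_sum, pow_two (v j _), this]
      simp
    · intro y
      simp only [ha]
      rw [← add_div]
      refine div_le_div_of_nonneg_right ?_ hn0
      simp only [hflip, Function.update_self, hτ, boolSign]
      simp
      nlinarith [sq_nonneg (∑ i, v j i * est y i)]
  have hpair : ∀ j τ, c ≤ φ j τ + φ j (flip j τ) := fun j τ => by
    cases hτ : τ j
    · have := htrue j (flip j τ) (by simp [hflip, hτ])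
      rwa [hflipinv j, add_comm] at this
    · exact htrue j τ hτ
  have hsum : ∀ j, (Fintype.card (J → Bool) : ℝ≥0∞) * c ≤ 2 * ∑ τ, φ j τ := fun j => by
    have e : ∑ τ, φ j (flip j τ) = ∑ τ, φ j τ :=
      Equiv.sum_comp (hflipinv j).toPerm (φ j)
    calc (Fintype.card (J → Bool) : ℝ≥0∞) * c = ∑ _τ : J → Bool, c := by simp
      _ ≤ ∑ τ, (φ j τ + φ j (flip j τ)) := Finset.sum_le_sum fun τ _ => hpair j τ
      _ = 2 * ∑ τ, φ j τ := by rw [Finset.sum_add_distrib, e, two_mul]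
  -- The supremum `R` is at least the average risk over the vertices, and pairing each vertex with
  -- its flip bounds that average below.
  have htot : (Fintype.card (J → Bool) : ℝ≥0∞) * (Fintype.card J * c) ≤
      (Fintype.card (J → Bool) : ℝ≥0∞) * (2 * R) := by
    calc (Fintype.card (J → Bool) : ℝ≥0∞) * (Fintype.card J * c)
        = ∑ _j : J, (Fintype.card (J → Bool) : ℝ≥0∞) * c := by
          rw [Finset.sum_const, Finset.card_univ, nsmul_eq_mul]; ring
      _ ≤ ∑ j, 2 * ∑ τ, φ j τ := Finset.sum_le_sum fun j _ => hsum j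
      _ = 2 * ∑ τ, ∑ j, φ j τ := by rw [← Finset.mul_sum, Finset.sum_comm]
      _ ≤ 2 * ∑ _τ : J → Bool, R := by gcongr with τ; exact hrisk τ
      _ = _ := by rw [Finset.sum_const, Finset.card_univ, nsmul_eq_mul]; ring
  have h2 : (Fintype.card J : ℝ≥0∞) * c ≤ 2 * R :=
    (ENNReal.mul_le_mul_iff_right (by simp) (by simp)).1 htot
  have e2 : (Fintype.card J : ℝ≥0∞) * c =
      2 * ENNReal.ofReal (Real.exp (-1) / 2 * (σ ^ 2 * Fintype.card J / n)) := by
    rw [hc, ← ENNReal.ofReal_natCast, ← ENNReal.ofReal_mul (by positivity),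
      ← ENNReal.ofReal_ofNat, ← ENNReal.ofReal_mul (by positivity)]
    congr 1
    ring
  rw [e2] at h2
  exact (ENNReal.mul_le_mul_iff_right (by simp) (by simp)).1 h2

end

/-! ### Edges of the grid and the spectrum of its Laplacian. -/

section

variable {d N : ℕ}

/-- The neighbour `x + e_j` of a lattice point, or the point itself at the boundary. -/
def gridStep (j : Fin d) (x : GridPoint d N) : GridPoint d N :=
  if h : (x j : ℕ) + 1 < N then Function.update x j ⟨x j + 1, h⟩ else x

lemma gridStep_apply_self {j : Fin d} {x : GridPoint d N} (h : (x j : ℕ) + 1 < N) :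
    (gridStep j x j : ℕ) = x j + 1 := by
  simp [gridStep, h]

lemma gridStep_apply_of_ne {i j : Fin d} (x : GridPoint d N) (h : i ≠ j) :
    gridStep j x i = x i := by
  unfold gridStep
  split_ifs <;> simp [h]

/-- The edges of the grid, sorted by direction. -/
lemma sum_gridEdge {M : Type*} [AddCommMonoid M] (F : GridPoint d N → GridPoint d N → M) :
    ∑ e : GridEdge d N, F e.1.1 e.1.2 =
      ∑ j, ∑ x : GridPoint d N, if (x j : ℕ) + 1 < N then F x (gridStep j x) else 0 := by
  rw [← Fintype.sum_prod_type' fun j (x : GridPoint d N) =>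
    if (x j : ℕ) + 1 < N then F x (gridStep j x) else 0, ← Finset.sum_filter,
    Finset.sum_subtype (p := fun p : Fin d × GridPoint d N => (p.2 p.1 : ℕ) + 1 < N) _ (by simp)]
  symm
  refine Fintype.sum_bijective (fun p => ⟨(p.1.2, gridStep p.1.1 p.1.2), p.1.1,
    gridStep_apply_self p.2, fun i hi => gridStep_apply_of_ne _ hi⟩) ⟨?_, ?_⟩ _ _ fun p => rfl
  · rintro ⟨⟨j, x⟩, h⟩ ⟨⟨l, y⟩, h'⟩ e
    simp only [Subtype.mk.injEq, Prod.mk.injEq] at e ⊢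
    obtain ⟨rfl, e⟩ := e
    refine ⟨?_, rfl⟩
    by_contra hne
    have h1 := gridStep_apply_self h
    dsimp only at h1
    rw [e, gridStep_apply_of_ne _ hne] at h1
    omega
  · rintro ⟨⟨x, y⟩, j, h1, h2⟩
    have h : (x j : ℕ) + 1 < N := by
      dsimp only at h1
      rw [← h1]; exact (y j).2
    refine ⟨⟨(j, x), h⟩, Subtype.ext (Prod.ext rfl (funext fun i => ?_))⟩
    by_cases hi : i = j
    · subst hi
      exact Fin.ext ((gridStep_apply_self h).trans h1.symm)
    · exact (gridStep_apply_of_ne _ hi).trans (h2 i hi).symm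

lemma card_gridEdge_le : Fintype.card (GridEdge d N) ≤ d * N ^ d := by
  have := sum_gridEdge (d := d) (N := N) fun _ _ => 1
  simp only [Finset.sum_const, Finset.card_univ, smul_eq_mul, mul_one] at this
  rw [this]
  calc _ ≤ ∑ _j : Fin d, ∑ _x : GridPoint d N, 1 := by
        gcongr with j _ x
        split_ifs <;> simp
    _ = d * N ^ d := by simp

lemma gridIncidence_mulVec (u : GridPoint d N → ℝ) (e : GridEdge d N) :
    (gridIncidence d N).mulVec u e = u e.1.2 - u e.1.1 := by
  simp [Matrix.mulVec, dotProduct, gridIncidence, sub_mul, Finset.sum_sub_distrib]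

lemma gridLaplacian_mulVec (u : GridPoint d N → ℝ) (y : GridPoint d N) :
    (gridLaplacian d N).mulVec u y =
      ∑ e : GridEdge d N, ((if y = e.1.2 then 1 else 0) - (if y = e.1.1 then 1 else 0)) *
        (u e.1.2 - u e.1.1) := by
  rw [gridLaplacian, ← Matrix.mulVec_mulVec]
  simp only [Matrix.mulVec, dotProduct, Matrix.transpose_apply]
  refine Finset.sum_congr rfl fun e _ => ?_
  rw [← gridIncidence_mulVec]
  rfl

/-- For odd orders this turns the `ℓ²` norm of `D L^q θ` into a quadratic form in `L`, so
eigenvectors of `L` suffice and `D` needs no diagonalisation. -/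
lemma sum_sq_gridIncidence_mulVec (u : GridPoint d N → ℝ) :
    ∑ e, (gridIncidence d N).mulVec u e ^ 2 = ∑ x, u x * (gridLaplacian d N).mulVec u x := by
  have := Matrix.dotProduct_mulVec u (gridIncidence d N).transpose ((gridIncidence d N).mulVec u)
  rw [Matrix.vecMul_transpose, Matrix.mulVec_mulVec] at this
  simp only [dotProduct] at this
  rw [gridLaplacian, this]
  simp [pow_two]

/-- A function whose differences along each axis are given by a flux that vanishes at the boundary
has the divergence of the flux as its Laplacian. -/
lemma gridLaplacian_mulVec_of_flux (u : GridPoint d N → ℝ) (G : Fin d → GridPoint d N → ℝ)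
    (H : Fin d → GridPoint d N → ℝ)
    (hG0 : ∀ j x, (x j : ℕ) = 0 → G j x = 0)
    (hH0 : ∀ j x, ¬ (x j : ℕ) + 1 < N → H j x = 0)
    (hH : ∀ j x, (x j : ℕ) + 1 < N → u (gridStep j x) - u x = H j x)
    (hGH : ∀ j x, (x j : ℕ) + 1 < N → G j (gridStep j x) = H j x) (y : GridPoint d N) :
    (gridLaplacian d N).mulVec u y = ∑ j, (G j y - H j y) := by
  rw [gridLaplacian_mulVec, sum_gridEdge fun x z =>
    ((if y = z then 1 else 0) - (if y = x then 1 else 0)) * (u z - u x)]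
  refine Finset.sum_congr rfl fun j _ => ?_
  have e : ∀ x : GridPoint d N, (if (x j : ℕ) + 1 < N then
      ((if y = gridStep j x then (1 : ℝ) else 0) - (if y = x then 1 else 0)) *
        (u (gridStep j x) - u x) else 0) =
      (if (x j : ℕ) + 1 < N ∧ y = gridStep j x then G j y else 0) -
        (if y = x then H j y else 0) := fun x => by
    by_cases h : (x j : ℕ) + 1 < N
    · rw [if_pos h, hH j x h]
      by_cases h1 : y = gridStep j x <;> by_cases h2 : y = x
      · rw [← h2] at h1 h
        have := gridStep_apply_self h
        rw [← h1] at this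
        omega
      · rw [← hGH j x h, ← h1]; simp [h, h2]
      · subst h2; simp [h1]
      · simp [h1, h2]
    · rw [if_neg h]
      by_cases h2 : y = x
      · subst h2; simp [h, hH0 j y h]
      · simp [h, h2]
  rw [Finset.sum_congr rfl fun x _ => e x, Finset.sum_sub_distrib, Finset.sum_ite_eq]
  simp only [Finset.mem_univ, if_true]
  congr 1
  -- Off the lower face `y` has exactly one predecessor along `j`; on that face it has none, and the
  -- incoming flux is zero.
  by_cases hy : (y j : ℕ) = 0
  · rw [hG0 j y hy]; simp
  · have hlt := (y j).2
    set z : GridPoint d N := Function.update y j ⟨y j - 1, by omega⟩ with hz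
    have hzj : (z j : ℕ) = y j - 1 := by simp [hz]
    have hzN : (z j : ℕ) + 1 < N := by omega
    have hzy : y = gridStep j z := funext fun i => by
      by_cases hi : i = j
      · subst hi
        refine Fin.ext ?_
        rw [gridStep_apply_self hzN]; omega
      · rw [gridStep_apply_of_ne _ hi]; simp [hz, hi]
    rw [Finset.sum_eq_single z]
    · rw [if_pos ⟨hzN, hzy⟩]
    · rintro x - hx
      refine if_neg fun ⟨h, hyx⟩ => hx (funext fun i => ?_)
      by_cases hi : i = j
      · subst hi
        have := gridStep_apply_self h
        rw [← hyx] at this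
        exact Fin.ext (by omega)
      · rw [← gridStep_apply_of_ne x hi, ← hyx]; simp [hz, hi]
    · simp

/-- The eigenfunctions of the path Laplacian with Neumann boundary. -/
noncomputable def pathCos (N m a : ℕ) : ℝ := Real.cos (Real.pi * m / N * (a + 1 / 2))

/-- The increment `pathCos N m a - pathCos N m (a - 1)`, extended to the boundary. -/
noncomputable def pathFlux (N m a : ℕ) : ℝ :=
  -2 * Real.sin (Real.pi * m / N / 2) * Real.sin (Real.pi * m / N * a)

/-- The eigenvalues of the path Laplacian. -/
noncomputable def pathEigenvalue (N m : ℕ) : ℝ := 4 * Real.sin (Real.pi * m / N / 2) ^ 2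

lemma pathCos_succ_sub (N m a : ℕ) : pathCos N m (a + 1) - pathCos N m a = pathFlux N m (a + 1) := by
  unfold pathCos pathFlux
  rw [Real.cos_sub_cos]
  push_cast
  have e1 : (Real.pi * m / N * ((a + 1 : ℝ) + 1 / 2) + Real.pi * m / N * (a + 1 / 2)) / 2 =
    Real.pi * m / N * (a + 1) := by ring
  have e2 : (Real.pi * m / N * ((a + 1 : ℝ) + 1 / 2) - Real.pi * m / N * (a + 1 / 2)) / 2 =
    Real.pi * m / N / 2 := by ring
  rw [e1, e2]
  ring

lemma pathFlux_sub_succ (N m a : ℕ) :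
    pathFlux N m a - pathFlux N m (a + 1) = pathEigenvalue N m * pathCos N m a := by
  unfold pathCos pathFlux pathEigenvalue
  have := Real.sin_sub_sin (Real.pi * m / N * (a + 1 : ℝ)) (Real.pi * m / N * a)
  have e1 : (Real.pi * m / N * (a + 1 : ℝ) - Real.pi * m / N * a) / 2 = Real.pi * m / N / 2 := by ring
  have e2 : (Real.pi * m / N * (a + 1 : ℝ) + Real.pi * m / N * a) / 2 =
    Real.pi * m / N * (a + 1 / 2) := by ring
  rw [e1, e2] at this
  push_cast
  linear_combination 2 * Real.sin (Real.pi * m / N / 2) * this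

@[simp] lemma pathFlux_zero (N m : ℕ) : pathFlux N m 0 = 0 := by simp [pathFlux]

@[simp] lemma pathFlux_self (N m : ℕ) : pathFlux N m N = 0 := by
  rcases eq_or_ne N 0 with rfl | h
  · simp
  · have : Real.pi * m / N * N = m * Real.pi := by field_simp
    simp [pathFlux, this, Real.sin_nat_mul_pi]

lemma pathEigenvalue_nonneg (N m : ℕ) : 0 ≤ pathEigenvalue N m := by
  unfold pathEigenvalue; positivity

lemma pathEigenvalue_le (N m : ℕ) : pathEigenvalue N m ≤ (Real.pi * m / N) ^ 2 := by
  have h0 : 0 ≤ Real.pi * m / N / 2 := by positivity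
  have h := Real.abs_sin_le_abs (x := Real.pi * m / N / 2)
  have := sq_le_sq.2 h
  unfold pathEigenvalue
  linarith

lemma pathEigenvalue_injOn (N : ℕ) : Set.InjOn (pathEigenvalue N) {m | m < N} := by
  intro m hm l hl e
  have hm : m < N := hm
  have hl : l < N := hl
  have hN : (0 : ℝ) < N := by exact_mod_cast (Nat.zero_le m).trans_lt hm
  have hmem : ∀ k : ℕ, k < N → 0 ≤ Real.pi * k / N / 2 ∧ Real.pi * k / N / 2 ≤ Real.pi / 2 := by
    intro k hk
    refine ⟨by positivity, ?_⟩
    have : (k : ℝ) ≤ N := by exact_mod_cast hk.le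
    have : Real.pi * k / N ≤ Real.pi := by
      rw [div_le_iff₀ hN]; gcongr
    linarith
  have hpi := Real.pi_pos
  have hs : ∀ k : ℕ, k < N → 0 ≤ Real.sin (Real.pi * k / N / 2) := fun k hk =>
    Real.sin_nonneg_of_nonneg_of_le_pi (hmem k hk).1 (by linarith [(hmem k hk).2])
  unfold pathEigenvalue at e
  have e' := (pow_left_inj₀ (hs m hm) (hs l hl) two_ne_zero).1 (by linarith)
  have := Real.injOn_sin ⟨by linarith [(hmem m hm).1], (hmem m hm).2⟩
    ⟨by linarith [(hmem l hl).1], (hmem l hl).2⟩ e'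
  field_simp at this
  exact_mod_cast this

/-- Summation by parts. The boundary terms disappear because the flux vanishes at both `0` and `N`.
-/
lemma sum_pathFlux_mul (N m : ℕ) (g : ℕ → ℝ) :
    ∑ a ∈ Finset.range N, pathFlux N m (a + 1) * (g (a + 1) - g a) =
      pathEigenvalue N m * ∑ a ∈ Finset.range N, pathCos N m a * g a := by
  have : ∀ n, ∑ a ∈ Finset.range n, pathFlux N m (a + 1) * (g (a + 1) - g a) =
      pathEigenvalue N m * ∑ a ∈ Finset.range n, pathCos N m a * g a + pathFlux N m n * g n := by
    intro n
    induction n with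
    | zero => simp
    | succ n ih =>
      rw [Finset.sum_range_succ, Finset.sum_range_succ, ih]
      linear_combination g n * pathFlux_sub_succ N m n
  simp [this]

/-- Both products with the eigenvalues equal the same symmetric sum of fluxes, and the eigenvalues
are distinct. -/
lemma sum_pathCos_mul_of_ne {m l : ℕ} (hm : m < N) (hl : l < N) (h : m ≠ l) :
    ∑ a : Fin N, pathCos N m a * pathCos N l a = 0 := by
  rw [Fin.sum_univ_eq_sum_range fun a => pathCos N m a * pathCos N l a]
  have h1 := sum_pathFlux_mul N m (pathCos N l)
  have h2 := sum_pathFlux_mul N l (pathCos N m)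
  simp only [pathCos_succ_sub] at h1 h2
  simp only [mul_comm (pathFlux N l _), mul_comm (pathCos N l _)] at h2
  have hne : pathEigenvalue N m - pathEigenvalue N l ≠ 0 :=
    sub_ne_zero.2 fun e => h (pathEigenvalue_injOn N hm hl e)
  refine (mul_eq_zero.1 ?_).resolve_left hne
  rw [sub_mul, ← h1, ← h2, sub_self]

/-- Guarantees a nonzero norm, so normalisation requires no explicit value of it. -/
lemma pathCos_zero_pos {m : ℕ} (hm : m < N) : 0 < pathCos N m 0 := by
  have hN : (0 : ℝ) < N := by exact_mod_cast (Nat.zero_le m).trans_lt hm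
  have hmN : (m : ℝ) < N := by exact_mod_cast hm
  have hpi := Real.pi_pos
  have h : Real.pi * m / N < Real.pi := by
    rw [div_lt_iff₀ hN]; gcongr
  have h0 : 0 ≤ Real.pi * m / N := by positivity
  refine Real.cos_pos_of_mem_Ioo ⟨?_, ?_⟩
  · push_cast; linarith
  · push_cast; linarith

/-- The eigenfunctions of the grid Laplacian. -/
noncomputable def gridCos (d N : ℕ) (m : Fin d → ℕ) (x : GridPoint d N) : ℝ :=
  ∏ i, pathCos N (m i) (x i)

lemma gridLaplacian_mulVec_gridCos (m : Fin d → ℕ) :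
    (gridLaplacian d N).mulVec (gridCos d N m) = (∑ j, pathEigenvalue N (m j)) • gridCos d N m := by
  have split : ∀ (j : Fin d) (x : GridPoint d N),
      gridCos d N m x = pathCos N (m j) (x j) * ∏ i ∈ Finset.univ.erase j, pathCos N (m i) (x i) :=
    fun j x => (Finset.mul_prod_erase _ _ (Finset.mem_univ j)).symm
  have step : ∀ (j : Fin d) (x : GridPoint d N),
      ∏ i ∈ Finset.univ.erase j, pathCos N (m i) (gridStep j x i) =
        ∏ i ∈ Finset.univ.erase j, pathCos N (m i) (x i) := fun j x =>
    Finset.prod_congr rfl fun i hi => by rw [gridStep_apply_of_ne _ (Finset.ne_of_mem_erase hi)]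
  ext y
  rw [gridLaplacian_mulVec_of_flux _
    (fun j x => pathFlux N (m j) (x j) * ∏ i ∈ Finset.univ.erase j, pathCos N (m i) (x i))
    (fun j x => pathFlux N (m j) (x j + 1) * ∏ i ∈ Finset.univ.erase j, pathCos N (m i) (x i))]
  · rw [Pi.smul_apply, smul_eq_mul, Finset.sum_mul]
    refine Finset.sum_congr rfl fun j _ => ?_
    rw [← sub_mul, pathFlux_sub_succ, split j y]
    ring
  · intro j x h; simp [h]
  · intro j x h
    have : (x j : ℕ) + 1 = N := by have := (x j).2; omega
    simp [this]
  · intro j x h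
    rw [split j, split j, step, gridStep_apply_self h, ← sub_mul, pathCos_succ_sub]
  · intro j x h
    rw [step, gridStep_apply_self h]

lemma sum_gridCos_mul (m l : Fin d → ℕ) :
    ∑ x, gridCos d N m x * gridCos d N l x =
      ∏ i, ∑ a : Fin N, pathCos N (m i) a * pathCos N (l i) a := by
  rw [Finset.prod_univ_sum, Fintype.piFinset_univ]
  simp_rw [gridCos, Finset.prod_mul_distrib]

lemma sum_gridCos_mul_of_ne {m l : Fin d → ℕ} (hm : ∀ i, m i < N) (hl : ∀ i, l i < N)
    (h : m ≠ l) : ∑ x, gridCos d N m x * gridCos d N l x = 0 := by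
  obtain ⟨i, hi⟩ := Function.ne_iff.1 h
  rw [sum_gridCos_mul]
  exact Finset.prod_eq_zero (Finset.mem_univ i) (sum_pathCos_mul_of_ne (hm i) (hl i) hi)

lemma sum_gridCos_mul_self_pos {m : Fin d → ℕ} (hm : ∀ i, m i < N) :
    0 < ∑ x, gridCos d N m x * gridCos d N m x := by
  rw [sum_gridCos_mul]
  refine Finset.prod_pos fun i _ => Finset.sum_pos' (fun a _ => mul_self_nonneg _) ?_
  exact ⟨⟨0, (Nat.zero_le _).trans_lt (hm i)⟩, Finset.mem_univ _,
    mul_self_pos.2 (pathCos_zero_pos (hm i)).ne'⟩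

/-- Orthonormal eigenvectors of the grid Laplacian with the `r ^ d` lowest frequencies. -/
lemma exists_orthonormal_gridLaplacian_eigenvectors {r : ℕ} (hr : r ≤ N) :
    ∃ (v : (Fin d → Fin r) → GridPoint d N → ℝ) (μ : (Fin d → Fin r) → ℝ),
      (∀ m l, ∑ x, v m x * v l x = if m = l then 1 else 0) ∧
      (∀ m, (gridLaplacian d N).mulVec (v m) = μ m • v m) ∧
      ∀ m, 0 ≤ μ m ∧ μ m ≤ d * (Real.pi * (r - 1) / N) ^ 2 := by
  set c : (Fin d → Fin r) → Fin d → ℕ := fun m i => m i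
  have hc : ∀ m i, c m i < N := fun m i => (m i).2.trans_le hr
  have hinj : ∀ m l, c m = c l → m = l := fun m l h => funext fun i => Fin.ext (congrFun h i)
  set S : (Fin d → Fin r) → ℝ := fun m => ∑ x, gridCos d N (c m) x * gridCos d N (c m) x with hS
  have hS0 : ∀ m, 0 < S m := fun m => sum_gridCos_mul_self_pos (hc m)
  refine ⟨fun m => (√(S m))⁻¹ • gridCos d N (c m), fun m => ∑ j, pathEigenvalue N (m j), ?_, ?_, ?_⟩
  · intro m l
    have e : ∑ x, ((√(S m))⁻¹ • gridCos d N (c m)) x * ((√(S l))⁻¹ • gridCos d N (c l)) x =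
        (√(S m))⁻¹ * (√(S l))⁻¹ * ∑ x, gridCos d N (c m) x * gridCos d N (c l) x := by
      rw [Finset.mul_sum]
      refine Finset.sum_congr rfl fun x _ => ?_
      simp only [Pi.smul_apply, smul_eq_mul]
      ring
    rw [e]
    split_ifs with h
    · subst h
      rw [← mul_inv, Real.mul_self_sqrt (hS0 m).le]
      exact inv_mul_cancel₀ (hS0 m).ne'
    · rw [sum_gridCos_mul_of_ne (hc m) (hc l) fun h' => h (hinj _ _ h'), mul_zero]
  · intro m
    rw [Matrix.mulVec_smul, gridLaplacian_mulVec_gridCos, smul_comm]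
  · refine fun m => ⟨Finset.sum_nonneg fun j _ => pathEigenvalue_nonneg _ _, ?_⟩
    -- Frequencies start at `0`, hence `r - 1` and not `r`: for `r = 1` the bound is zero, which
    -- puts the constants in the class for every `C ≥ 0`.
    have : ∀ j ∈ Finset.univ, pathEigenvalue N (m j) ≤ (Real.pi * (r - 1) / N) ^ 2 := fun j _ => by
      refine (pathEigenvalue_le _ _).trans ?_
      have h1 : ((m j : ℕ) : ℝ) + 1 ≤ r := by exact_mod_cast (m j).2
      have h2 : ((m j : ℕ) : ℝ) ≤ r - 1 := by linarith
      gcongr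
    simpa using Finset.sum_le_card_nsmul _ _ _ this

/-- Low frequency signals lie in the total variation class. -/
lemma gtfNorm_le_of_eigenvectors {J : Type*} [Fintype J] [DecidableEq J]
    {v : J → GridPoint d N → ℝ} {μ : J → ℝ} {B : ℝ} (hd : 1 ≤ d)
    (hv : ∀ j l, ∑ x, v j x * v l x = if j = l then 1 else 0)
    (hL : ∀ j, (gridLaplacian d N).mulVec (v j) = μ j • v j) (hμ : ∀ j, 0 ≤ μ j ∧ μ j ≤ B)
    (a : J → ℝ) (p : ℕ) :
    gtfNorm d N p (fun x => ∑ j, a j * v j x) ^ 2 ≤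
      d * (N : ℝ) ^ d * (B ^ p * ∑ j, a j ^ 2) := by
  have hpow : ∀ q : ℕ, ∀ j, (gridLaplacian d N ^ q).mulVec (v j) = μ j ^ q • v j := by
    intro q j
    induction q with
    | zero => simp
    | succ q ih => rw [pow_succ, ← Matrix.mulVec_mulVec, hL, Matrix.mulVec_smul, ih, smul_smul, pow_succ,
        mul_comm]
  have happ : ∀ (q : ℕ) (b : J → ℝ), (gridLaplacian d N ^ q).mulVec (fun x => ∑ j, b j * v j x) =
      fun x => ∑ j, (b j * μ j ^ q) * v j x := by
    intro q b
    have : (fun x => ∑ j, b j * v j x) = ∑ j, b j • v j := by ext x; simp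
    rw [this, Matrix.mulVec_sum]
    ext x
    rw [Finset.sum_apply]
    refine Finset.sum_congr rfl fun j _ => ?_
    rw [Matrix.mulVec_smul, hpow]
    simp only [Pi.smul_apply, smul_eq_mul]
    ring
  have hfin : ∑ j, μ j ^ p * a j ^ 2 ≤ B ^ p * ∑ j, a j ^ 2 := by
    rw [Finset.mul_sum]
    refine Finset.sum_le_sum fun j _ => ?_
    gcongr
    · exact (hμ j).1
    · exact (hμ j).2
  have hd1 : (1 : ℝ) ≤ d := by exact_mod_cast hd
  have hs0 : 0 ≤ ∑ j, μ j ^ p * a j ^ 2 :=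
    Finset.sum_nonneg fun j _ => mul_nonneg (pow_nonneg (hμ j).1 _) (sq_nonneg _)
  refine le_trans ?_ (mul_le_mul_of_nonneg_left hfin (by positivity))
  unfold gtfNorm
  split_ifs with hp
  · obtain ⟨q, rfl⟩ := hp
    have hq : (q + q) / 2 = q := by omega
    -- Passage from `ℓ¹` to `ℓ²` by Cauchy–Schwarz. Low frequency signals are spread out, so the
    -- loss is only a constant factor.
    refine sq_sum_le_card_mul_sum_sq.trans ?_
    simp_rw [sq_abs, hq, happ, sum_sq_combination_of_orthonormal hv]
    have e : ∑ j, (a j * μ j ^ q) ^ 2 = ∑ j, μ j ^ (q + q) * a j ^ 2 :=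
      Finset.sum_congr rfl fun j _ => by ring
    rw [e]
    have : ((Finset.univ : Finset (GridPoint d N)).card : ℝ) ≤ d * (N : ℝ) ^ d := by
      simp only [Finset.card_univ, Fintype.card_fun, Fintype.card_fin, Nat.cast_pow]
      exact le_mul_of_one_le_left (by positivity) hd1
    exact mul_le_mul_of_nonneg_right this hs0
  · obtain ⟨q, rfl⟩ := Nat.not_even_iff_odd.1 hp
    have hq : (2 * q + 1) / 2 = q := by omega
    refine sq_sum_le_card_mul_sum_sq.trans ?_
    simp_rw [sq_abs, hq, ← Matrix.mulVec_mulVec, sum_sq_gridIncidence_mulVec, happ]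
    have h1 := happ 1 fun j => a j * μ j ^ q
    rw [pow_one] at h1
    rw [h1]
    have e : ∑ x, (∑ j, a j * μ j ^ q * v j x) * ∑ j, a j * μ j ^ q * μ j ^ 1 * v j x =
        ∑ j, μ j ^ (2 * q + 1) * a j ^ 2 := by
      simp_rw [Finset.sum_mul]
      rw [Finset.sum_comm]
      refine Finset.sum_congr rfl fun j _ => ?_
      simp_rw [mul_assoc (a j * μ j ^ q)]
      rw [← Finset.mul_sum]
      have := sum_mul_combination_of_orthonormal hv (fun j => a j * (μ j ^ q * μ j ^ 1)) j
      simp_rw [mul_assoc] at this ⊢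
      rw [this]
      ring
    rw [e]
    have : ((Finset.univ : Finset (GridEdge d N)).card : ℝ) ≤ d * (N : ℝ) ^ d := by
      exact_mod_cast card_gridEdge_le (d := d) (N := N)
    exact mul_le_mul_of_nonneg_right this hs0

end

/-! ### Bounds in `ℓ¹`, and the three lower bounds on the risk. -/

section

variable {d N : ℕ}

lemma gridStep_injOn (j : Fin d) :
    Set.InjOn (gridStep (N := N) j) {x | (x j : ℕ) + 1 < N} := by
  intro x hx y hy h
  refine funext fun i => ?_
  by_cases hi : i = j
  · subst hi
    have h1 := gridStep_apply_self hx
    rw [h, gridStep_apply_self hy] at h1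
    exact Fin.ext (by omega)
  · rw [← gridStep_apply_of_ne x hi, h, gridStep_apply_of_ne y hi]

lemma sum_abs_gridIncidence_mulVec_le (u : GridPoint d N → ℝ) :
    ∑ e, |(gridIncidence d N).mulVec u e| ≤ 2 * d * ∑ x, |u x| := by
  simp_rw [gridIncidence_mulVec]
  rw [sum_gridEdge fun x y => |u y - u x|]
  have key : ∀ j : Fin d, (∑ x : GridPoint d N,
      if (x j : ℕ) + 1 < N then |u (gridStep j x) - u x| else 0) ≤ 2 * ∑ x, |u x| := fun j => by
    rw [← Finset.sum_filter]
    set s := Finset.univ.filter fun x : GridPoint d N => (x j : ℕ) + 1 < N with hs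
    have h1 : ∑ x ∈ s, |u (gridStep j x)| ≤ ∑ x, |u x| := by
      rw [← Finset.sum_image (f := fun y => |u y|) (g := gridStep j) (s := s)
        fun x hx y hy h => gridStep_injOn j (by simpa [hs] using hx) (by simpa [hs] using hy) h]
      exact Finset.sum_le_univ_sum_of_nonneg fun _ => abs_nonneg _
    have h2 : ∑ x ∈ s, |u x| ≤ ∑ x, |u x| :=
      Finset.sum_le_univ_sum_of_nonneg fun _ => abs_nonneg _
    calc ∑ x ∈ s, |u (gridStep j x) - u x| ≤ ∑ x ∈ s, (|u (gridStep j x)| + |u x|) :=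
          Finset.sum_le_sum fun x _ => abs_sub _ _
      _ ≤ 2 * ∑ x, |u x| := by rw [Finset.sum_add_distrib]; linarith
  calc _ ≤ ∑ _j : Fin d, 2 * ∑ x, |u x| := Finset.sum_le_sum fun j _ => key j
    _ = _ := by simp; ring

lemma sum_abs_gridIncidence_transpose_mulVec_le (w : GridEdge d N → ℝ) :
    ∑ x, |(gridIncidence d N).transpose.mulVec w x| ≤ 2 * ∑ e, |w e| := by
  have h : ∀ e : GridEdge d N, ∑ x, |gridIncidence d N e x| ≤ 2 := fun e => by
    calc ∑ x, |gridIncidence d N e x| ≤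
        ∑ x, (|(if x = e.1.2 then 1 else 0 : ℝ)| + |(if x = e.1.1 then 1 else 0 : ℝ)|) :=
          Finset.sum_le_sum fun x _ => abs_sub _ _
      _ = 2 := by
          simp only [apply_ite abs, abs_one, abs_zero, Finset.sum_add_distrib, Finset.sum_ite_eq',
            Finset.mem_univ, if_true]
          norm_num
  calc _ ≤ ∑ x, ∑ e, |gridIncidence d N e x| * |w e| := by
        refine Finset.sum_le_sum fun x _ => (Finset.abs_sum_le_sum_abs _ _).trans ?_
        simp [abs_mul]
    _ = ∑ e, (∑ x, |gridIncidence d N e x|) * |w e| := by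
        rw [Finset.sum_comm]; simp_rw [Finset.sum_mul]
    _ ≤ ∑ e, 2 * |w e| := by gcongr with e _; exact h e
    _ = _ := by rw [Finset.mul_sum]

lemma sum_abs_gridLaplacian_pow_mulVec_le (q : ℕ) (u : GridPoint d N → ℝ) :
    ∑ x, |(gridLaplacian d N ^ q).mulVec u x| ≤ (4 * d) ^ q * ∑ x, |u x| := by
  induction q with
  | zero => simp
  | succ q ih =>
    rw [pow_succ', ← Matrix.mulVec_mulVec, gridLaplacian, ← Matrix.mulVec_mulVec, ← gridLaplacian]
    refine (sum_abs_gridIncidence_transpose_mulVec_le _).trans ?_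
    have h := sum_abs_gridIncidence_mulVec_le ((gridLaplacian d N ^ q).mulVec u)
    have h2 : (2 * d : ℝ) * ∑ x, |(gridLaplacian d N ^ q).mulVec u x| ≤
        2 * d * ((4 * d) ^ q * ∑ x, |u x|) := by gcongr
    rw [pow_succ]
    linarith

/-- On `ℓ¹`, `D` costs `2d` and `Dᵀ` costs `2`, so each factor `L` costs `4d`. Since `4d ≥ 1`, the
exponent may be enlarged to `p`. -/
lemma gtfNorm_le_sum_abs (hd : 1 ≤ d) (p : ℕ) (u : GridPoint d N → ℝ) :
    gtfNorm d N p u ≤ (4 * d) ^ p * ∑ x, |u x| := by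
  have hd1 : (1 : ℝ) ≤ d := by exact_mod_cast hd
  have h1 : (1 : ℝ) ≤ 4 * d := by linarith
  have h0 : 0 ≤ ∑ x, |u x| := Finset.sum_nonneg fun _ _ => abs_nonneg _
  unfold gtfNorm
  split_ifs with hp
  · refine (sum_abs_gridLaplacian_pow_mulVec_le _ _).trans ?_
    gcongr
    exact Nat.div_le_self _ _
  · obtain ⟨q, rfl⟩ := Nat.not_even_iff_odd.1 hp
    have hq : (2 * q + 1) / 2 = q := by omega
    simp_rw [hq, ← Matrix.mulVec_mulVec]
    refine (sum_abs_gridIncidence_mulVec_le _).trans ?_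
    calc _ ≤ 2 * d * ((4 * d) ^ q * ∑ x, |u x|) := by
          gcongr; exact sum_abs_gridLaplacian_pow_mulVec_le _ _
      _ ≤ 4 * d * ((4 * d) ^ q * ∑ x, |u x|) := by gcongr; norm_num
      _ = (4 * d) ^ (q + 1) * ∑ x, |u x| := by ring
      _ ≤ _ := by
          gcongr
          omega

/-- Lower bound from `m` spikes. -/
lemma spike_bound {k m : ℕ} {σ C : ℝ} (hd : 1 ≤ d) (hσ : 0 < σ) (hm : m ≤ N ^ d)
    (hC : (4 * d : ℝ) ^ (k + 1) * (σ * m) ≤ C) :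
    ENNReal.ofReal (Real.exp (-1) / 2 * (σ ^ 2 * m / (N : ℝ) ^ d)) ≤
      normalMinimaxRisk σ (gtvClass k d N C) := by
  obtain ⟨s, -, hs⟩ := Finset.exists_subset_card_eq (s := (Finset.univ : Finset (GridPoint d N)))
    (n := m) (by simpa using hm)
  have h := assouad_bound (J := s) (v := fun j => Pi.single j.1 1) (K := gtvClass k d N C) hσ ?_ ?_
  · simpa [hs] using h
  · intro j l
    simp only [Pi.single_apply, ite_mul, one_mul, zero_mul, Finset.sum_ite_eq', Finset.mem_univ,
      if_true, Subtype.ext_iff]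
  · intro τ
    refine (gtfNorm_le_sum_abs hd _ _).trans (le_trans ?_ hC)
    gcongr
    calc _ ≤ ∑ x, ∑ j : s, |σ * boolSign (τ j) * (Pi.single j.1 1 : GridPoint d N → ℝ) x| :=
          Finset.sum_le_sum fun x _ => Finset.abs_sum_le_sum_abs _ _
      _ = ∑ j : s, |σ * boolSign (τ j)| := by
          rw [Finset.sum_comm]
          refine Finset.sum_congr rfl fun j _ => ?_
          simp [Pi.single_apply, apply_ite abs]
      _ = ∑ _j : s, σ := by
          refine Finset.sum_congr rfl fun j _ => ?_
          cases τ j <;> simp [boolSign, hσ.le]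
      _ ≤ σ * m := by simp [hs, mul_comm]

/-- Lower bound from the `r ^ d` lowest frequencies. -/
lemma low_frequency_bound {k r : ℕ} {σ C : ℝ} (hd : 1 ≤ d) (hσ : 0 < σ) (hC0 : 0 ≤ C) (hr : r ≤ N)
    (hC : d * (N : ℝ) ^ d * ((d * (Real.pi * (r - 1) / N) ^ 2) ^ (k + 1) * (σ ^ 2 * (r : ℝ) ^ d)) ≤
      C ^ 2) :
    ENNReal.ofReal (Real.exp (-1) / 2 * (σ ^ 2 * (r : ℝ) ^ d / (N : ℝ) ^ d)) ≤
      normalMinimaxRisk σ (gtvClass k d N C) := by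
  obtain ⟨v, μ, hv, hL, hμ⟩ := exists_orthonormal_gridLaplacian_eigenvectors (d := d) hr
  have h := assouad_bound (v := v) (K := gtvClass k d N C) hσ hv fun τ => ?_
  · simpa using h
  · refine abs_le_of_sq_le_sq' ?_ hC0 |>.2
    refine (gtfNorm_le_of_eigenvectors hd hv hL hμ _ _).trans (le_trans (le_of_eq ?_) hC)
    simp [mul_pow, mul_comm]

lemma constant_bound {k : ℕ} {σ C : ℝ} (hd : 1 ≤ d) (hN : 1 ≤ N) (hσ : 0 < σ) (hC0 : 0 ≤ C) :
    ENNReal.ofReal (Real.exp (-1) / 2 * (σ ^ 2 / (N : ℝ) ^ d)) ≤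
      normalMinimaxRisk σ (gtvClass k d N C) := by
  simpa using low_frequency_bound (k := k) (r := 1) hd hσ hC0 hN (by simp; positivity)

lemma sparse_rate_bound {k : ℕ} {σ C : ℝ} (hd : 1 ≤ d) (hN : 1 ≤ N) (hσ : 0 < σ) (hC0 : 0 ≤ C) :
    ENNReal.ofReal (Real.exp (-1) / 2 / (2 * (4 * d) ^ (k + 1)) *
      min (σ * C / (N : ℝ) ^ d) (σ ^ 2)) ≤ normalMinimaxRisk σ (gtvClass k d N C) := by
  set K : ℝ := (4 * d : ℝ) ^ (k + 1) with hK
  have hd1 : (1 : ℝ) ≤ d := by exact_mod_cast hd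
  have hK1 : 1 ≤ K := one_le_pow₀ (by linarith)
  have hn : (0 : ℝ) < (N : ℝ) ^ d := by positivity
  have hE := Real.exp_pos (-1)
  have hle : ∀ {x y : ℝ}, min (σ * C / (N : ℝ) ^ d) (σ ^ 2) ≤ 2 * K * x → Real.exp (-1) / 2 * x = y →
      Real.exp (-1) / 2 / (2 * K) * min (σ * C / (N : ℝ) ^ d) (σ ^ 2) ≤ y := by
    rintro x y h rfl
    calc _ ≤ Real.exp (-1) / 2 / (2 * K) * (2 * K * x) := by gcongr
      _ = _ := by field_simp
  -- The class has room for `⌊C / (Kσ)⌋` spikes. If this is zero, `C < Kσ` and the constant signals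
  -- suffice; if it is at least `n`, every point carries a spike. Otherwise rounding down costs the
  -- factor `2` in `2K`.
  have hfl : (⌊C / (K * σ)⌋₊ : ℝ) ≤ C / (K * σ) := Nat.floor_le (by positivity)
  have hlt := Nat.lt_floor_add_one (C / (K * σ))
  rw [div_lt_iff₀ (by positivity)] at hlt
  rw [le_div_iff₀ (by positivity)] at hfl
  rcases Nat.eq_zero_or_pos ⌊C / (K * σ)⌋₊ with h0 | h0
  · refine le_trans (ENNReal.ofReal_le_ofReal (hle ?_ rfl)) (constant_bound hd hN hσ hC0)
    refine (min_le_left _ _).trans ?_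
    rw [← mul_div_assoc]
    refine div_le_div_of_nonneg_right ?_ hn.le
    rw [h0] at hlt
    push_cast at hlt
    nlinarith [mul_pos hσ (mul_pos (one_pos.trans_le hK1) hσ)]
  · rcases le_total (N ^ d) ⌊C / (K * σ)⌋₊ with h1 | h1
    · refine le_trans (ENNReal.ofReal_le_ofReal (hle ?_ rfl))
        (spike_bound (k := k) hd hσ le_rfl ?_)
      · refine (min_le_right _ _).trans ?_
        push_cast
        rw [mul_div_assoc, div_self hn.ne', mul_one]
        nlinarith [sq_nonneg σ]
      · have h2 : ((N ^ d : ℕ) : ℝ) ≤ ⌊C / (K * σ)⌋₊ := by exact_mod_cast h1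
        rw [← hK]
        calc K * (σ * ((N ^ d : ℕ) : ℝ)) ≤ K * (σ * ⌊C / (K * σ)⌋₊) := by gcongr
          _ ≤ C := by linarith
    · refine le_trans (ENNReal.ofReal_le_ofReal (hle ?_ rfl)) (spike_bound (k := k) hd hσ h1 ?_)
      · refine (min_le_left _ _).trans ?_
        rw [← mul_div_assoc]
        refine div_le_div_of_nonneg_right ?_ hn.le
        have h2 : (1 : ℝ) ≤ ⌊C / (K * σ)⌋₊ := by exact_mod_cast h0
        have h3 : C ≤ 2 * ⌊C / (K * σ)⌋₊ * (K * σ) := hlt.le.trans (by gcongr; linarith)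
        have := mul_le_mul_of_nonneg_left h3 hσ.le
        linarith
      · rw [← hK]; linarith

/-- The fraction of the frequencies used in the smooth regime. -/
noncomputable def smoothScale (k d : ℕ) : ℝ :=
  ((d : ℝ) ^ (k + 2) * 2 ^ d * Real.pi ^ (2 * (k + 1)))⁻¹

lemma smoothScale_pos (k : ℕ) (hd : 1 ≤ d) : 0 < smoothScale k d := by
  have : (0 : ℝ) < d := by exact_mod_cast hd
  unfold smoothScale; positivity

lemma smoothScale_le (k : ℕ) (hd : 1 ≤ d) : smoothScale k d ≤ 1 / 2 := by
  have hd1 : (1 : ℝ) ≤ d := by exact_mod_cast hd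
  have h1 : (1 : ℝ) ≤ (d : ℝ) ^ (k + 2) := one_le_pow₀ hd1
  have h2 : (2 : ℝ) ≤ 2 ^ d := le_self_pow₀ (by norm_num) (by omega)
  have h3 : (1 : ℝ) ≤ Real.pi ^ (2 * (k + 1)) := one_le_pow₀ (by linarith [Real.pi_gt_three])
  rw [smoothScale, one_div]
  refine inv_anti₀ two_pos ?_
  calc (2 : ℝ) = 1 * 2 * 1 := by norm_num
    _ ≤ _ := by gcongr

/-- Here `y` is the fraction of frequencies per axis that the radius allows, up to a constant, and
the minimum with `1` says that only `N` exist. -/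
lemma smooth_rate_bound {k : ℕ} {σ C y : ℝ} (hd : 1 ≤ d) (hN : 1 ≤ N) (hσ : 0 < σ) (hC0 : 0 ≤ C)
    (hy0 : 0 ≤ y) (hy : y ^ (2 * (k + 1) + d) ≤ (C / ((N : ℝ) ^ d * σ)) ^ 2) :
    ENNReal.ofReal (Real.exp (-1) / 2 * smoothScale k d ^ d * (σ ^ 2 * min y 1 ^ d)) ≤
      normalMinimaxRisk σ (gtvClass k d N C) := by
  set ε := smoothScale k d with hε
  have hε0 : 0 < ε := smoothScale_pos k hd
  have hε1 : ε ≤ 1 / 2 := smoothScale_le k hd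
  set z := min y 1 with hz
  have hz0 : 0 ≤ z := le_min hy0 zero_le_one
  have hz1 : z ≤ 1 := min_le_right _ _
  have hd1 : (1 : ℝ) ≤ d := by exact_mod_cast hd
  have hNpos : (0 : ℝ) < N := by exact_mod_cast hN
  have hn : (0 : ℝ) < (N : ℝ) ^ d := by positivity
  set T := ε * (N * z) with hT
  have hT0 : 0 ≤ T := by positivity
  have hfl : (⌊T⌋₊ : ℝ) ≤ T := Nat.floor_le hT0
  have hlt := Nat.lt_floor_add_one T
  have hTN : 2 * T ≤ N := by
    have : N * z ≤ N := mul_le_of_le_one_right hNpos.le hz1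
    have : ε * (N * z) ≤ 1 / 2 * N := by gcongr
    linarith
  -- The choice `r = ⌊T⌋ + 1` exceeds `T`, as the rate requires. If `⌊T⌋ = 0`, only constants are
  -- used; otherwise `r - 1 ≤ T` and `r ≤ 2T ≤ N`.
  refine le_trans (ENNReal.ofReal_le_ofReal ?_)
    (low_frequency_bound (k := k) (r := ⌊T⌋₊ + 1) hd hσ hC0 ?_ ?_)
  · have h1 : T ^ d ≤ ((⌊T⌋₊ + 1 : ℕ) : ℝ) ^ d := by
      gcongr; push_cast; exact hlt.le
    have h2 : T ^ d / (N : ℝ) ^ d = ε ^ d * z ^ d := by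
      rw [hT, mul_pow, mul_pow]; field_simp
    have h3 : ε ^ d * z ^ d ≤ ((⌊T⌋₊ + 1 : ℕ) : ℝ) ^ d / (N : ℝ) ^ d := by
      rw [← h2]; gcongr
    calc _ = Real.exp (-1) / 2 * σ ^ 2 * (ε ^ d * z ^ d) := by ring
      _ ≤ Real.exp (-1) / 2 * σ ^ 2 * (((⌊T⌋₊ + 1 : ℕ) : ℝ) ^ d / (N : ℝ) ^ d) := by gcongr
      _ = _ := by ring
  · rcases Nat.eq_zero_or_pos ⌊T⌋₊ with h0 | h0
    · rw [h0]; exact hN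
    · have h2 : (1 : ℝ) ≤ ⌊T⌋₊ := by exact_mod_cast h0
      have h3 : ((⌊T⌋₊ + 1 : ℕ) : ℝ) ≤ N := by push_cast; linarith
      exact_mod_cast h3
  · rcases Nat.eq_zero_or_pos ⌊T⌋₊ with h0 | h0
    · simp [h0]; positivity
    · have h2 : (1 : ℝ) ≤ ⌊T⌋₊ := by exact_mod_cast h0
      push_cast
      rw [add_sub_cancel_right]
      have h3 : (⌊T⌋₊ : ℝ) + 1 ≤ 2 * T := by linarith
      have hπ := Real.pi_pos
      -- The prefactor collects the constants of the membership condition, with `2 ^ d` coming from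
      -- `r ≤ 2T`. `smoothScale` is its inverse, and one power of `ε` absorbs it.
      have hεε : (d : ℝ) ^ (k + 2) * 2 ^ d * Real.pi ^ (2 * (k + 1)) * ε ^ (2 * (k + 1) + d) ≤ 1 := by
        have : ε ^ (2 * (k + 1) + d) ≤ ε := pow_le_of_le_one hε0.le (by linarith) (by omega)
        calc _ ≤ (d : ℝ) ^ (k + 2) * 2 ^ d * Real.pi ^ (2 * (k + 1)) * ε := by gcongr
          _ = 1 := by
            rw [hε, smoothScale]
            exact mul_inv_cancel₀ (by positivity)
      have hzy : z ^ (2 * (k + 1) + d) ≤ (C / ((N : ℝ) ^ d * σ)) ^ 2 :=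
        le_trans (by gcongr; exact min_le_left _ _) hy
      calc d * (N : ℝ) ^ d * ((d * (Real.pi * ⌊T⌋₊ / N) ^ 2) ^ (k + 1) *
            (σ ^ 2 * ((⌊T⌋₊ : ℝ) + 1) ^ d))
          ≤ d * (N : ℝ) ^ d * ((d * (Real.pi * T / N) ^ 2) ^ (k + 1) * (σ ^ 2 * (2 * T) ^ d)) := by
            gcongr
        _ = ((d : ℝ) ^ (k + 2) * 2 ^ d * Real.pi ^ (2 * (k + 1)) * ε ^ (2 * (k + 1) + d)) *
            z ^ (2 * (k + 1) + d) * ((N : ℝ) ^ d * σ) ^ 2 := by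
            have : Real.pi * T / N = Real.pi * (ε * z) := by rw [hT]; field_simp
            rw [this, hT]
            ring
        _ ≤ 1 * (C / ((N : ℝ) ^ d * σ)) ^ 2 * ((N : ℝ) ^ d * σ) ^ 2 := by gcongr
        _ = C ^ 2 := by field_simp

end

/-! ### Assembly of the three rates. -/

theorem theorem7 (k d : ℕ) (hd : 1 ≤ d) :
    ∃ c : ℝ, 0 < c ∧ ∀ N : ℕ, 1 ≤ N → ∀ σ C : ℝ, 0 < σ → 0 ≤ C →
      ∀ n s : ℝ, n = (N : ℝ) ^ d → s = ((k : ℝ) + 1) / (d : ℝ) →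
        ENNReal.ofReal (c *
            (σ ^ 2 / n
              + min (σ * C / n) (σ ^ 2)
              + min ((C / n) ^ (2 / (2 * s + 1)) * σ ^ (4 * s / (2 * s + 1))) (σ ^ 2)))
          ≤ normalMinimaxRisk σ (gtvClass k d N C) := by
  have hd1 : (1 : ℝ) ≤ d := by exact_mod_cast hd
  set c₁ : ℝ := Real.exp (-1) / 2
  set c₂ : ℝ := Real.exp (-1) / 2 / (2 * (4 * d) ^ (k + 1))
  set c₃ : ℝ := Real.exp (-1) / 2 * smoothScale k d ^ d
  have hc₁ : 0 < c₁ := by positivity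
  have hc₂ : 0 < c₂ := by positivity
  have hc₃ : 0 < c₃ := mul_pos hc₁ (pow_pos (smoothScale_pos k hd) d)
  set c := min c₁ (min c₂ c₃)
  have hc : 0 < c := lt_min hc₁ (lt_min hc₂ hc₃)
  -- Each of the three terms times `c` is at most the risk, so their sum times `c / 3` is too.
  refine ⟨c / 3, by positivity, ?_⟩
  rintro N hN σ C hσ hC n s rfl rfl
  set R := normalMinimaxRisk σ (gtvClass k d N C)
  have hNpos : (0 : ℝ) < N := by exact_mod_cast hN
  set n := (N : ℝ) ^ d with hn
  have hn0 : 0 < n := by positivity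
  have h1 : ENNReal.ofReal (c * (σ ^ 2 / n)) ≤ R :=
    (ENNReal.ofReal_le_ofReal (by gcongr; exact min_le_left _ _)).trans
      (constant_bound hd hN hσ hC)
  have h2 : ENNReal.ofReal (c * min (σ * C / n) (σ ^ 2)) ≤ R := by
    refine (ENNReal.ofReal_le_ofReal ?_).trans (sparse_rate_bound (k := k) hd hN hσ hC)
    exact mul_le_mul_of_nonneg_right ((min_le_right _ _).trans (min_le_left _ _)) (by positivity)
  have h3 : ENNReal.ofReal (c * min ((C / n) ^ (2 / (2 * (((k : ℝ) + 1) / d) + 1)) *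
      σ ^ (4 * (((k : ℝ) + 1) / d) / (2 * (((k : ℝ) + 1) / d) + 1))) (σ ^ 2)) ≤ R := by
    -- The signal to noise ratio `x` makes the third term homogeneous: it becomes `σ² min(y, 1)^d`,
    -- with `y` solving the membership condition with equality.
    set x := C / (n * σ) with hx
    have hx0 : 0 ≤ x := by positivity
    set y := x ^ (2 / (2 * ((k : ℝ) + 1) + d)) with hy
    have hy0 : 0 ≤ y := by positivity
    have hyp : y ^ (2 * (k + 1) + d) = x ^ 2 := by
      rw [hy, ← Real.rpow_mul_natCast hx0, ← Real.rpow_natCast]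
      congr 1
      push_cast
      field_simp
    refine (ENNReal.ofReal_le_ofReal ?_).trans (smooth_rate_bound (k := k) hd hN hσ hC hy0 hyp.le)
    have hyd : y ^ d = x ^ (2 / (2 * (((k : ℝ) + 1) / d) + 1)) := by
      rw [hy, ← Real.rpow_mul_natCast hx0]
      congr 1
      field_simp
    have e : (C / n) ^ (2 / (2 * (((k : ℝ) + 1) / d) + 1)) *
        σ ^ (4 * (((k : ℝ) + 1) / d) / (2 * (((k : ℝ) + 1) / d) + 1)) = σ ^ 2 * y ^ d := by
      have : C / n = x * σ := by rw [hx]; field_simp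
      rw [hyd, this, Real.mul_rpow hx0 hσ.le, mul_assoc, ← Real.rpow_add hσ, mul_comm,
        ← Real.rpow_natCast σ 2]
      congr 2
      field_simp
      push_cast
      ring
    have e2 : min (σ ^ 2 * y ^ d) (σ ^ 2) = σ ^ 2 * min y 1 ^ d := by
      rcases le_total y 1 with h | h
      · rw [min_eq_left h, min_eq_left]
        exact mul_le_of_le_one_right (sq_nonneg σ) (pow_le_one₀ hy0 h)
      · rw [min_eq_right h, min_eq_right, one_pow, mul_one]
        exact le_mul_of_one_le_right (sq_nonneg σ) (one_le_pow₀ h)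
    rw [e, e2]
    exact mul_le_mul_of_nonneg_right ((min_le_right _ _).trans (min_le_right _ _)) (by positivity)
  rcases eq_or_ne R ⊤ with hR | hR
  · rw [hR]; exact le_top
  · rw [ENNReal.ofReal_le_iff_le_toReal hR] at h1 h2 h3 ⊢
    linarith
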